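/- Let $1\le p<q<\infty$. For a real Banach space $Y$ with unit sphere $S_Y$ and $t\in(0,1)$, put $$\tilde\delta_Y(t)=\inf_{x\in S_Y}\ \sup_{Z}\ \inf_{z\in S_Z}\ \max\{\|x+tz\|,\|x-tz\|\}-1,$$ where $Z$ runs over the closed linear subspaces of $Y$ of finite codimension, $S_Z$ is the unit sphere of $Z$, and infima over the empty set are $+\infty$. The space $Y$ is called $p$-asymptotically midpoint uniformly convex if there is a constant $c>0$ such that $\tilde\delta_Y(t)\ge c\,t^p$ for all $t\in(0,1)$. A metric space $(X,d_X)$ bi-Lipschitzly embeds into a metric space $(Y,d_Y)$ if there are a map $f\colon X\to Y$ and constants $s>0$, $D\ge 1$ such that $s\,d_X(x,y)\le d_Y(f(x),f(y))\le D\,s\,d_X(x,y)$ for all $x,y\in X$. Then the real Banach space $L_q[0,1]$ does not bi-Lipschitzly embed into any $p$-asymptotically midpoint uniformly convex Banach space. In particular, $L_q[0,1]$ does not bi-Lipschitzly embed into $\ell_p$. -/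

import Mathlib

open MeasureTheory
open scoped ENNReal NNReal

noncomputable section

/-- `X` bi-Lipschitzly embeds into `Y`: for some map `f : X → Y`, scaling factor `s > 0` and
distortion `D ≥ 1`, one has `s * d(x, y) ≤ d(f x, f y) ≤ D * s * d(x, y)` for all `x, y`. -/
def BiLipschitzEmbeds (X Y : Type*) [MetricSpace X] [MetricSpace Y] : Prop :=
  ∃ (f : X → Y) (s D : ℝ), 0 < s ∧ 1 ≤ D ∧
    ∀ x y : X, s * dist x y ≤ dist (f x) (f y) ∧ dist (f x) (f y) ≤ D * s * dist x y

/-- The modulus of asymptotic midpoint uniform convexity of the norm of `X`,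
`inf_{‖x‖ = 1} sup_Z inf_{z ∈ Z, ‖z‖ = 1} max {‖x + t z‖, ‖x - t z‖} - 1`, where `Z` runs over the
closed subspaces of finite codimension. It takes values in the extended reals, so that an infimum
over an empty set is `⊤`: all values are `⊤` for finite-dimensional `X`. -/
def amucModulus (X : Type*) [NormedAddCommGroup X] [NormedSpace ℝ X] (t : ℝ) : EReal :=
  (⨅ x ∈ Metric.sphere (0 : X) 1,
    ⨆ Z ∈ {Z : Submodule ℝ X | IsClosed (Z : Set X) ∧ FiniteDimensional ℝ (X ⧸ Z)},
      ⨅ z ∈ (Z : Set X) ∩ Metric.sphere (0 : X) 1,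
        ((max ‖x + t • z‖ ‖x - t • z‖ : ℝ) : EReal)) - 1

/-- The norm of `X` is `p`-asymptotically midpoint uniformly convex: its modulus of asymptotic
midpoint uniform convexity is bounded below by `c * t ^ p` on `(0, 1)`, for some `c > 0`. -/
def IsPowerTypeAMUC (p : ℝ) (X : Type*) [NormedAddCommGroup X] [NormedSpace ℝ X] : Prop :=
  ∃ c : ℝ, 0 < c ∧ ∀ t ∈ Set.Ioo (0 : ℝ) 1, ((c * t ^ p : ℝ) : EReal) ≤ amucModulus X t

/-- The real Banach space `L_q[0,1]`, for Lebesgue measure on `[0,1]`. -/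
abbrev LqUnit (q : ℝ) : Type :=
  Lp ℝ (ENNReal.ofReal q) (volume.restrict (Set.Icc (0 : ℝ) 1))

/-- The real sequence space `ℓ_p`. -/
abbrev EllP (p : ℝ) : Type := lp (fun _ : ℕ => ℝ) (ENNReal.ofReal p)

end

/-! The obstruction is the size of approximate midpoint sets. In `L_q`, adding to the midpoint of
two points disjoint normalized bumps of relative size `ε` gives infinitely many `ε`-separated
approximate midpoints, with relative error of order `ε ^ q` (`exists_separated_midpoints_Lp`). In a
space with modulus at least `c * t ^ p`, infinitely many approximate midpoints with separation of
order `t` force an error of at least `c * t ^ p` (`le_of_separated_approx_midpoints`).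

An embedding carries the first picture to the second: if a pair of points almost attains the best
Lipschitz constant, approximate midpoints go to approximate midpoints, and the lower Lipschitz bound
keeps them separated. Hence `ε ^ p` is at most a constant times `ε ^ q`, which fails for small `ε`
as `p < q`. For `ℓ_p` the modulus is bounded below using tail subspaces (`isPowerTypeAMUC_ellP`). -/

/-! ### Approximate midpoints in the target space -/

/-- On the sphere of a suitable finite-codimensional subspace, `max ‖u + t z‖ ‖u - t z‖` comes
arbitrarily close to the bound given by the modulus. -/
lemma exists_submodule_of_le_amucModulus {Y : Type*} [NormedAddCommGroup Y] [NormedSpace ℝ Y]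
    {t a r : ℝ} (h : (a : EReal) ≤ amucModulus Y t) {u : Y} (hu : ‖u‖ = 1) (hr : r < a) :
    ∃ Z : Submodule ℝ Y, IsClosed (Z : Set Y) ∧ FiniteDimensional ℝ (Y ⧸ Z) ∧
      ∀ z ∈ Z, ‖z‖ = 1 → 1 + r < max ‖u + t • z‖ ‖u - t • z‖ := by
  have h1 := EReal.add_le_of_le_sub h
  have h2 : ((1 + r : ℝ) : EReal) < (a : EReal) + 1 := by
    rw [← EReal.coe_one, ← EReal.coe_add, EReal.coe_lt_coe_iff]
    linarith
  have h3 := (h2.trans_le h1).trans_le (iInf₂_le u (by simpa using hu))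
  simp only [lt_iSup_iff] at h3
  obtain ⟨Z, ⟨hZ1, hZ2⟩, hZ⟩ := h3
  refine ⟨Z, hZ1, hZ2, fun z hz hz1 => ?_⟩
  have h4 := hZ.trans_le (iInf₂_le z ⟨hz, by simpa using hz1⟩)
  exact_mod_cast h4

/-- A bounded sequence has two terms whose difference is close to a given closed subspace of finite
codimension. -/
lemma exists_sub_near_submodule {Y : Type*} [NormedAddCommGroup Y] [NormedSpace ℝ Y]
    (Z : Submodule ℝ Y) [IsClosed (Z : Set Y)] [FiniteDimensional ℝ (Y ⧸ Z)] {w : ℕ → Y} {R η : ℝ}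
    (hw : ∀ n, ‖w n‖ ≤ R) (hη : 0 < η) :
    ∃ m n : ℕ, m ≠ n ∧ ∃ v ∈ Z, ‖w m - w n - v‖ < η := by
  -- In the finite-dimensional quotient the bounded image sequence has a Cauchy subsequence; a small
  -- difference there lifts to a small vector `y`.
  have : ProperSpace (Y ⧸ Z) := FiniteDimensional.proper ℝ _
  obtain ⟨a, -, φ, hφ, hlim⟩ := tendsto_subseq_of_bounded
    (Metric.isBounded_closedBall (x := (0 : Y ⧸ Z)) (r := R)) (x := fun n => Z.mkQ (w n))
    (fun n => by
      simpa using (Submodule.Quotient.norm_mk_le Z (w n)).trans (hw n))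
  obtain ⟨N, hN⟩ := Metric.cauchySeq_iff.1 hlim.cauchySeq (η / 2) (by positivity)
  refine ⟨φ N, φ (N + 1), (hφ (Nat.lt_succ_self N)).ne, ?_⟩
  have h1 := hN N le_rfl (N + 1) (Nat.le_succ N)
  obtain ⟨y, hy1, hy2⟩ := Submodule.Quotient.norm_mk_lt
    (Z.mkQ (w (φ N) - w (φ (N + 1)))) (half_pos hη)
  refine ⟨w (φ N) - w (φ (N + 1)) - y, ?_, ?_⟩
  · exact (Submodule.Quotient.eq Z).1 hy1.symm
  · rw [sub_sub_cancel]
    rw [dist_eq_norm] at h1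
    simp only [Function.comp_apply, ← map_sub] at h1
    linarith

lemma norm_add_smul_le_max {Y : Type*} [NormedAddCommGroup Y] [NormedSpace ℝ Y] (u v : Y) {a : ℝ}
    (ha : |a| ≤ 1) : ‖u + a • v‖ ≤ max ‖u + v‖ ‖u - v‖ := by
  obtain ⟨h1, h2⟩ := abs_le.1 ha
  have : u + a • v = ((1 + a) / 2) • (u + v) + ((1 - a) / 2) • (u - v) := by module
  rw [this]
  refine (norm_add_le _ _).trans ?_
  rw [norm_smul, norm_smul, Real.norm_of_nonneg (by linarith), Real.norm_of_nonneg (by linarith)]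
  nlinarith [le_max_left ‖u + v‖ ‖u - v‖, le_max_right ‖u + v‖ ‖u - v‖]

/-- If the set of approximate midpoints of `u` and `-u` contains an infinite `4 t`-separated
sequence, then the modulus at `t` is at most the midpoint error. -/
lemma le_of_separated_approx_midpoints {Y : Type*} [NormedAddCommGroup Y] [NormedSpace ℝ Y]
    {t a δ : ℝ} (ht : 0 < t) (h : (a : EReal) ≤ amucModulus Y t) {u : Y} (hu : ‖u‖ = 1) {w : ℕ → Y}
    (hw : ∀ n, ‖u + w n‖ ≤ 1 + δ ∧ ‖u - w n‖ ≤ 1 + δ)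
    (hsep : ∀ m n, m ≠ n → 4 * t ≤ ‖w m - w n‖) : a ≤ δ := by
  by_contra! hlt
  obtain ⟨r, hδr, hra⟩ := exists_between hlt
  obtain ⟨Z, hZc, hZf, hZ⟩ := exists_submodule_of_le_amucModulus h hu hra
  have hbdd : ∀ n, ‖w n‖ ≤ 2 + δ := fun n => by
    have := norm_sub_le (u + w n) u
    rw [add_sub_cancel_left, hu] at this
    linarith [(hw n).1]
  obtain ⟨m, n, hmn, v, hv, hvη⟩ :=
    exists_sub_near_submodule Z hbdd (lt_min (sub_pos.2 hδr) ht)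
  have hη1 := hvη.trans_le (min_le_left _ _)
  have hη2 := hvη.trans_le (min_le_right _ _)
  have hv2 : 2 * t ≤ ‖v‖ := by
    have h1 := norm_sub_norm_le (w m - w n) v
    linarith [hsep m n hmn]
  have hv0 : 0 < ‖v‖ := by linarith
  -- The point is the average of `u + w i` and `u - w j`, so differences inherit the midpoint error;
  -- swapping `i` and `j` gives the other sign.
  have hmid : ∀ i j, ‖u + (1 / 2 : ℝ) • (w i - w j)‖ ≤ 1 + δ := fun i j => by
    have : u + (1 / 2 : ℝ) • (w i - w j)
        = (1 / 2 : ℝ) • (u + w i) + (1 / 2 : ℝ) • (u - w j) := by module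
    rw [this]
    refine (norm_add_le _ _).trans ?_
    rw [norm_smul, norm_smul, Real.norm_of_nonneg (by norm_num)]
    linarith [(hw i).1, (hw j).2]
  have hhalf : ‖(1 / 2 : ℝ) • (w m - w n - v)‖ ≤ r - δ := by
    rw [norm_smul, Real.norm_of_nonneg (by norm_num)]
    linarith [norm_nonneg (w m - w n - v)]
  have hp : ‖u + (1 / 2 : ℝ) • v‖ ≤ 1 + r := by
    have : u + (1 / 2 : ℝ) • v
        = (u + (1 / 2 : ℝ) • (w m - w n)) - (1 / 2 : ℝ) • (w m - w n - v) := by module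
    rw [this]
    linarith [norm_sub_le (u + (1 / 2 : ℝ) • (w m - w n)) ((1 / 2 : ℝ) • (w m - w n - v)),
      hmid m n]
  have hq : ‖u - (1 / 2 : ℝ) • v‖ ≤ 1 + r := by
    have : u - (1 / 2 : ℝ) • v
        = (u + (1 / 2 : ℝ) • (w n - w m)) + (1 / 2 : ℝ) • (w m - w n - v) := by module
    rw [this]
    linarith [norm_add_le (u + (1 / 2 : ℝ) • (w n - w m)) ((1 / 2 : ℝ) • (w m - w n - v)),
      hmid n m]
  have hmax := max_le hp hq
  -- Since `v / 2` has length at least `t`, convexity allows shrinking it to length exactly `t`,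
  -- where `hZ` applies.
  have hs : |2 * t / ‖v‖| ≤ 1 := by
    rw [abs_of_nonneg (by positivity), div_le_one hv0]
    exact hv2
  have hsm : (2 * t / ‖v‖) • (1 / 2 : ℝ) • v = t • ‖v‖⁻¹ • v := by
    rw [smul_smul, smul_smul]
    congr 1
    ring
  have h1 := norm_add_smul_le_max u ((1 / 2 : ℝ) • v) hs
  have h2 := norm_add_smul_le_max u ((1 / 2 : ℝ) • v) (a := -(2 * t / ‖v‖)) (by rwa [abs_neg])
  rw [neg_smul, ← sub_eq_add_neg, hsm] at h2
  rw [hsm] at h1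
  have h3 := hZ (‖v‖⁻¹ • v) (Z.smul_mem _ hv) (by
    rw [norm_smul, norm_inv, norm_norm, inv_mul_cancel₀ hv0.ne'])
  linarith [max_le h1 h2]

/-! ### Transfer of midpoints through an embedding -/

/-- A space in which any two points have infinite separated sets of approximate midpoints, with an
error of power type `q`, does not embed into a space whose modulus has power type `p < q`. -/
theorem not_biLipschitzEmbeds_of_separated_midpoints {X Y : Type*} [NormedAddCommGroup X]
    [NormedSpace ℝ X] [Nontrivial X] [NormedAddCommGroup Y] [NormedSpace ℝ Y] {p q : ℝ} (hp : 1 ≤ p)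
    (hpq : p < q) (hY : IsPowerTypeAMUC p Y)
    (hX : ∀ (h : X) (ε : ℝ), 0 < ε → ∃ z : ℕ → X,
      (∀ n, ‖h + z n‖ ^ q ≤ ‖h‖ ^ q + (2 * ε) ^ q ∧ ‖h - z n‖ ^ q ≤ ‖h‖ ^ q + (2 * ε) ^ q) ∧
      ∀ m n, m ≠ n → ε ≤ ‖z m - z n‖) :
    ¬ BiLipschitzEmbeds X Y := by
  rintro ⟨f, s, D, hs, hD, hf⟩
  obtain ⟨c, hc, hcY⟩ := hY
  have hq : 0 < q := by linarith
  -- the optimal Lipschitz constant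
  set S : Set ℝ := {a | ∃ x y : X, x ≠ y ∧ a = dist (f x) (f y) / dist x y} with hS
  obtain ⟨x₀, y₀, hxy₀⟩ := exists_pair_ne X
  have hSne : S.Nonempty := ⟨_, x₀, y₀, hxy₀, rfl⟩
  have hSb : ∀ a ∈ S, a ≤ D * s := by
    rintro a ⟨x, y, hxy, rfl⟩
    rw [div_le_iff₀ (dist_pos.2 hxy)]
    exact (hf x y).2
  have hSbdd : BddAbove S := ⟨_, hSb⟩
  set L := sSup S with hL
  have hLD : L ≤ D * s := csSup_le hSne hSb
  have hsL : s ≤ L := by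
    refine le_trans ?_ (le_csSup hSbdd ⟨x₀, y₀, hxy₀, rfl⟩)
    rw [le_div_iff₀ (dist_pos.2 hxy₀)]
    exact (hf x₀ y₀).1
  have hL0 : 0 < L := hs.trans_le hsL
  have hLip : ∀ x y, ‖f x - f y‖ ≤ L * ‖x - y‖ := fun x y => by
    rcases eq_or_ne x y with rfl | hxy
    · simp
    · rw [← dist_eq_norm, ← dist_eq_norm, ← div_le_iff₀ (dist_pos.2 hxy)]
      exact le_csSup hSbdd ⟨x, y, hxy, rfl⟩
  have key : ∀ ε ∈ Set.Ioo (0 : ℝ) (1 / 2), c * (ε / (4 * D)) ^ p ≤ 3 * (2 * ε) ^ q := by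
    rintro ε ⟨hε, hε2⟩
    set δ : ℝ := (2 * ε) ^ q with hδ
    have hδ0 : 0 < δ := by positivity
    have hδ1 : δ ≤ 1 := Real.rpow_le_one (by positivity) (by linarith) hq.le
    -- The slack in the Lipschitz constant is matched to the midpoint error `δ`; the two factors `1
    -- + δ` are later absorbed into `1 + 3 * δ`, as `δ ≤ 1`.
    have hlt : L / (1 + δ) < sSup S := by
      rw [← hL, div_lt_iff₀ (by positivity)]
      nlinarith
    obtain ⟨_, ⟨x, y, hxy, rfl⟩, hxyL⟩ := exists_lt_of_lt_csSup hSne hlt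
    rw [dist_eq_norm, dist_eq_norm] at hxyL
    have hxy0 : 0 < ‖x - y‖ := norm_pos_iff.2 (sub_ne_zero.2 hxy)
    set h : X := (1 / 2 : ℝ) • (x - y) with hh
    have hnh : ‖h‖ = ‖x - y‖ / 2 := by
      rw [hh, norm_smul, Real.norm_of_nonneg (by norm_num)]
      ring
    have hh0 : 0 < ‖h‖ := by rw [hnh]; positivity
    obtain ⟨z, hz, hzsep⟩ := hX h (ε * ‖h‖) (by positivity)
    have hbound : ∀ g : X, ‖g‖ ^ q ≤ ‖h‖ ^ q + (2 * (ε * ‖h‖)) ^ q → ‖g‖ ≤ (1 + δ) * ‖h‖ := by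
      intro g hg
      rw [← mul_assoc, Real.mul_rpow (by positivity) (norm_nonneg h), ← hδ] at hg
      refine (Real.rpow_le_rpow_iff (norm_nonneg g) (by positivity) hq).1 ?_
      rw [Real.mul_rpow (by positivity) (norm_nonneg h)]
      have h1 : 1 + δ ≤ (1 + δ) ^ q := Real.self_le_rpow_of_one_le (by linarith) (by linarith)
      have h2 : 0 ≤ ‖h‖ ^ q := by positivity
      nlinarith
    set m : X := (1 / 2 : ℝ) • (x + y) with hm
    set U : Y := (1 / 2 : ℝ) • (f x - f y) with hU
    set W : ℕ → Y := fun n => f (m + z n) - (1 / 2 : ℝ) • (f x + f y) with hW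
    have hnU : ‖U‖ = ‖f x - f y‖ / 2 := by
      rw [hU, norm_smul, Real.norm_of_nonneg (by norm_num)]
      ring
    have hUl : L * ‖h‖ ≤ (1 + δ) * ‖U‖ := by
      rw [lt_div_iff₀ hxy0, div_mul_eq_mul_div, div_lt_iff₀ (by positivity)] at hxyL
      rw [hnh, hnU]
      linarith
    have hUu : ‖U‖ ≤ L * ‖h‖ := by
      rw [hnh, hnU]
      linarith [hLip x y]
    have hU0 : 0 < ‖U‖ := by
      by_contra! hcon
      nlinarith [mul_pos hL0 hh0]
    have hδ3 : (1 + δ) * ((1 + δ) * ‖U‖) ≤ (1 + 3 * δ) * ‖U‖ := by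
      have : (1 + δ) * (1 + δ) ≤ 1 + 3 * δ := by nlinarith
      nlinarith
    have hWm : ∀ n, ‖U - W n‖ ≤ (1 + 3 * δ) * ‖U‖ := fun n => by
      have e1 : U - W n = f x - f (m + z n) := by simp only [hU, hW]; module
      have e2 : x - (m + z n) = h - z n := by simp only [hm, hh]; module
      rw [e1]
      refine (hLip _ _).trans ?_
      rw [e2]
      nlinarith [hbound _ (hz n).2]
    have hWp : ∀ n, ‖U + W n‖ ≤ (1 + 3 * δ) * ‖U‖ := fun n => by
      have e1 : U + W n = f (m + z n) - f y := by simp only [hU, hW]; module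
      have e2 : (m + z n) - y = h + z n := by simp only [hm, hh]; module
      rw [e1]
      refine (hLip _ _).trans ?_
      rw [e2]
      nlinarith [hbound _ (hz n).1]
    have hWs : ∀ i j, i ≠ j → ε / D * ‖U‖ ≤ ‖W i - W j‖ := fun i j hij => by
      have e1 : W i - W j = f (m + z i) - f (m + z j) := by simp only [hW]; module
      have h1 := (hf (m + z i) (m + z j)).1
      rw [dist_eq_norm, dist_eq_norm, add_sub_add_left_eq_sub] at h1
      rw [e1]
      refine le_trans ?_ h1
      have h2 := mul_le_mul_of_nonneg_left (hzsep i j hij) hs.le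
      refine le_trans ?_ h2
      rw [div_mul_eq_mul_div, div_le_iff₀ (by linarith)]
      have h3 : ‖U‖ ≤ D * s * ‖h‖ := hUu.trans (by gcongr)
      nlinarith
    have hnorm : ∀ v : Y, ‖‖U‖⁻¹ • v‖ = ‖v‖ / ‖U‖ := fun v => by
      rw [norm_smul, norm_inv, norm_norm]
      ring
    have hD4 : ε / (4 * D) < 1 := by
      rw [div_lt_one (by linarith)]
      linarith
    -- After scaling `U` to norm one the separation is `ε / D`, which is `4 * t` for this `t`.
    refine le_of_separated_approx_midpoints (t := ε / (4 * D)) (by positivity)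
      (hcY _ ⟨by positivity, hD4⟩) (u := ‖U‖⁻¹ • U) (w := fun n => ‖U‖⁻¹ • W n) ?_ ?_ ?_
    · rw [hnorm, div_self hU0.ne']
    · intro n
      rw [← smul_add, ← smul_sub, hnorm, hnorm, div_le_iff₀ hU0, div_le_iff₀ hU0]
      exact ⟨hWp n, hWm n⟩
    · intro i j hij
      rw [← smul_sub, hnorm, le_div_iff₀ hU0]
      refine le_trans (le_of_eq ?_) (hWs i j hij)
      field_simp
  -- let `ε` tend to zero
  set C : ℝ := c * (1 / (4 * D)) ^ p / (3 * 2 ^ q) with hC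
  have hC0 : 0 < C := by positivity
  have hlim : Filter.Tendsto (fun ε : ℝ => ε ^ (q - p)) (nhdsWithin 0 (Set.Ioi 0)) (nhds 0) := by
    have := (Real.continuousAt_rpow_const 0 (q - p) (Or.inr (by linarith))).tendsto
    rw [Real.zero_rpow (by linarith)] at this
    exact this.mono_left nhdsWithin_le_nhds
  obtain ⟨ε, hε1, hε⟩ := ((hlim.eventually (gt_mem_nhds hC0)).and
    (Ioo_mem_nhdsGT (show (0 : ℝ) < 1 / 2 by norm_num))).exists
  have h1 := key ε hε
  have hε0 := hε.1
  rw [show ε / (4 * D) = ε * (1 / (4 * D)) by ring, Real.mul_rpow hε0.le (by positivity),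
    Real.mul_rpow (by norm_num) hε0.le] at h1
  rw [Real.rpow_sub hε0, hC, div_lt_div_iff₀ (by positivity) (by positivity)] at hε1
  linarith

/-! ### The modulus of `ℓ_p` -/

/-- The elements of `ℓ_p` which vanish on the coordinates below `N`. -/
def ellPTail (p : ℝ) [Fact (1 ≤ ENNReal.ofReal p)] (N : ℕ) : Submodule ℝ (EllP p) where
  carrier := {z | ∀ i < N, z i = 0}
  add_mem' := fun {a b} ha hb i hi => by simp [ha i hi, hb i hi]
  zero_mem' := fun i _ => by simp
  smul_mem' := fun c x hx i hi => by simp [hx i hi]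

lemma isClosed_ellPTail (p : ℝ) [Fact (1 ≤ ENNReal.ofReal p)] (N : ℕ) :
    IsClosed (ellPTail p N : Set (EllP p)) := by
  have : (ellPTail p N : Set (EllP p)) = ⋂ i, ⋂ _ : i < N, {z : EllP p | z i = 0} := by
    ext z
    simp only [Set.mem_iInter]
    exact Iff.rfl
  rw [this]
  refine isClosed_iInter fun i => isClosed_iInter fun _ => isClosed_eq ?_ continuous_const
  exact (lp.lipschitzWith_one_eval (E := fun _ : ℕ => ℝ) (ENNReal.ofReal p) i).continuous

lemma finiteDimensional_quotient_ellPTail (p : ℝ) [Fact (1 ≤ ENNReal.ofReal p)] (N : ℕ) :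
    FiniteDimensional ℝ (EllP p ⧸ ellPTail p N) := by
  let φ : EllP p →ₗ[ℝ] (Fin N → ℝ) :=
    { toFun := fun z i => z i
      map_add' := fun a b => by ext; simp
      map_smul' := fun a b => by ext; simp }
  have hk : LinearMap.ker φ = ellPTail p N := by
    ext z
    simp only [LinearMap.mem_ker, funext_iff, ellPTail]
    exact ⟨fun h i hi => h ⟨i, hi⟩, fun h i => h i i.2⟩
  rw [← hk]
  exact Module.Finite.equiv φ.quotKerEquivRange.symm

lemma exists_near_finite_support {p : ℝ} [Fact (1 ≤ ENNReal.ofReal p)] (x : EllP p)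
    {η : ℝ} (hη : 0 < η) : ∃ (N : ℕ) (y : EllP p), ‖x - y‖ < η ∧ ∀ i, N ≤ i → y i = 0 := by
  have h := (lp.hasSum_single (E := fun _ : ℕ => ℝ) ENNReal.ofReal_ne_top x).tendsto_sum_nat
  obtain ⟨N, hN⟩ := (Metric.tendsto_atTop.1 h η hη)
  refine ⟨N, ∑ i ∈ Finset.range N, lp.single (ENNReal.ofReal p) i (x i), ?_, fun i hi => ?_⟩
  · have := hN N le_rfl
    rwa [dist_comm, dist_eq_norm] at this
  · rw [lp.coeFn_sum, Finset.sum_apply]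
    refine Finset.sum_eq_zero fun j hj => ?_
    rw [lp.single_apply_ne]
    have := Finset.mem_range.1 hj
    omega

lemma norm_add_rpow_of_disjoint {p : ℝ} (hp : 1 ≤ p) [Fact (1 ≤ ENNReal.ofReal p)] {y z : EllP p}
    (h : ∀ i, y i = 0 ∨ z i = 0) : ‖y + z‖ ^ p = ‖y‖ ^ p + ‖z‖ ^ p := by
  have hp0 : 0 < p := by linarith
  have hpr : (ENNReal.ofReal p).toReal = p := ENNReal.toReal_ofReal hp0.le
  have hs : ∀ w : EllP p, HasSum (fun i => ‖w i‖ ^ p) (‖w‖ ^ p) := fun w => by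
    have := lp.hasSum_norm (by rwa [hpr]) w
    rwa [hpr] at this
  refine (hs (y + z)).unique ?_
  convert (hs y).add (hs z) using 2 with i
  rcases h i with h | h <;> simp [h, Real.zero_rpow hp0.ne']

/-- Convexity of the `p`-th power on the segment from `1` to `2 ^ (1 / p)`. With `a = t ^ p` it
bounds `(1 + t ^ p) ^ (1 / p)` below by `1 + c * t ^ p`. -/
lemma one_add_mul_rpow_le {p a : ℝ} (hp : 1 ≤ p) (ha : a ∈ Set.Icc (0 : ℝ) 1) :
    (1 + (2 ^ (1 / p) - 1) * a) ^ p ≤ 1 + a := by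
  have hb : (1 : ℝ) ≤ 2 ^ (1 / p) := Real.one_le_rpow (by norm_num) (by positivity)
  have h := (convexOn_rpow hp).2 (Set.mem_Ici.2 zero_le_one)
    (Set.mem_Ici.2 (zero_le_one.trans hb)) (by linarith [ha.2] : 0 ≤ 1 - a) ha.1 (by ring)
  simp only [smul_eq_mul, Real.one_rpow] at h
  rw [← Real.rpow_mul (by norm_num), one_div_mul_cancel (by linarith), Real.rpow_one] at h
  calc _ = ((1 - a) * 1 + a * 2 ^ (1 / p)) ^ p := by congr 1; ring
    _ ≤ _ := by linarith

/-- Finitely supported vectors are dense, and for such a `y` the `p`-th powers of norms add against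
vectors in the tail beyond its support. The bound already holds for `‖x + t • z‖` alone. -/
lemma isPowerTypeAMUC_ellP {p : ℝ} (hp : 1 ≤ p) [Fact (1 ≤ ENNReal.ofReal p)] :
    IsPowerTypeAMUC p (EllP p) := by
  have hp0 : 0 < p := by linarith
  have hc : (1 : ℝ) < 2 ^ (1 / p) := Real.one_lt_rpow (by norm_num) (by positivity)
  set c : ℝ := 2 ^ (1 / p) - 1 with hcdef
  refine ⟨c, by linarith, fun t ht => ?_⟩
  have ht0 := ht.1
  have htp : t ^ p ≤ 1 := Real.rpow_le_one ht0.le ht.2.le hp0.le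
  refine (EReal.le_sub_iff_add_le (.inl ?_) (.inl ?_)).2 ?_
  · exact EReal.coe_ne_bot 1
  · exact EReal.coe_ne_top 1
  refine le_iInf₂ fun x hx => ?_
  have hx1 : ‖x‖ = 1 := by simpa using hx
  rw [← EReal.coe_one, ← EReal.coe_add]
  refine EReal.ge_of_forall_gt_iff_ge.1 fun r hr => ?_
  rw [EReal.coe_lt_coe_iff] at hr
  have hc2 : 0 < 2 + c := by linarith
  -- Replacing `x` by `y` costs a factor `1 - η` and a further `η`, in total at most `(2 + c) * η`.
  obtain ⟨η, hη0, hη⟩ := exists_between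
    (lt_min one_pos (div_pos (sub_pos.2 hr) hc2) : (0 : ℝ) < min 1 ((c * t ^ p + 1 - r) / (2 + c)))
  have hη1 := hη.trans_le (min_le_left _ _)
  have hη2 := hη.trans_le (min_le_right _ _)
  rw [lt_div_iff₀ hc2] at hη2
  obtain ⟨N, y, hxy, hy⟩ := exists_near_finite_support x hη0
  refine le_trans ?_ (le_iSup₂ (ellPTail p N)
    ⟨isClosed_ellPTail p N, finiteDimensional_quotient_ellPTail p N⟩)
  refine le_iInf₂ fun z hz => ?_
  have hz1 : ‖z‖ = 1 := by simpa using hz.2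
  rw [EReal.coe_le_coe_iff]
  refine le_trans ?_ (le_max_left _ _)
  have hsum : ‖y + t • z‖ ^ p = ‖y‖ ^ p + t ^ p := by
    rw [norm_add_rpow_of_disjoint hp, norm_smul, hz1, mul_one, Real.norm_of_nonneg ht0.le]
    intro i
    rcases lt_or_ge i N with hi | hi
    · exact Or.inr (by simp [hz.1 i hi])
    · exact Or.inl (hy i hi)
  have hyη : 1 - η ≤ ‖y‖ := by linarith [norm_sub_norm_le x y]
  have hlow : (1 - η) * (1 + c * t ^ p) ≤ ‖y + t • z‖ := by
    refine (Real.rpow_le_rpow_iff (mul_nonneg (by linarith) ?_) (norm_nonneg _) hp0).1 ?_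
    · nlinarith [Real.rpow_nonneg ht0.le p]
    rw [hsum, Real.mul_rpow (by linarith) (by nlinarith [Real.rpow_nonneg ht0.le p])]
    have h1 : (1 - η) ^ p ≤ ‖y‖ ^ p := Real.rpow_le_rpow (by linarith) hyη hp0.le
    have h2 : (1 - η) ^ p ≤ 1 := Real.rpow_le_one (by linarith) (by linarith) hp0.le
    have h3 : 0 ≤ (1 - η) ^ p := Real.rpow_nonneg (by linarith) p
    have h4 : 0 ≤ t ^ p := Real.rpow_nonneg ht0.le p
    have h5 := mul_le_mul_of_nonneg_left (one_add_mul_rpow_le hp ⟨h4, htp⟩) h3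
    rw [← hcdef] at h5
    nlinarith
  have htri : ‖y + t • z‖ ≤ ‖x + t • z‖ + ‖x - y‖ := by
    have : y + t • z = (x + t • z) - (x - y) := by abel
    rw [this]
    exact norm_sub_le _ _
  have h6 : η * (c * t ^ p) ≤ η * c := by
    gcongr
    nlinarith
  linarith

/-! ### Separated approximate midpoints in `L_p` -/

section DisjointSupports

variable {α : Type*} [MeasurableSpace α] {μ : Measure α} {p : ℝ≥0∞}

lemma lintegral_enorm_rpow_eq (hp0 : p ≠ 0) (hp : p ≠ ∞) (f : α → ℝ) (ν : Measure α) :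
    ∫⁻ a, ‖f a‖ₑ ^ p.toReal ∂ν = eLpNorm f p ν ^ p.toReal := by
  rw [eLpNorm_eq_lintegral_rpow_enorm_toReal hp0 hp, one_div,
    ENNReal.rpow_inv_rpow (ENNReal.toReal_pos hp0 hp).ne']

/-- If `f` is small on a set outside which `g` vanishes, then `f` and `g` are almost disjoint. -/
lemma eLpNorm_add_rpow_le (hp1 : 1 ≤ p) (hp : p ≠ ∞) {f g : α → ℝ}
    (hf : AEStronglyMeasurable f μ) (hg : AEStronglyMeasurable g μ) {A : Set α}
    (hA : MeasurableSet A) (hgA : ∀ᵐ a ∂μ, a ∉ A → g a = 0) {ε : ℝ≥0∞}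
    (hfε : eLpNorm f p (μ.restrict A) ≤ ε) (hgε : eLpNorm g p μ ≤ ε) :
    eLpNorm (f + g) p μ ^ p.toReal ≤ eLpNorm f p μ ^ p.toReal + (2 * ε) ^ p.toReal := by
  have hp0 : p ≠ 0 := (zero_lt_one.trans_le hp1).ne'
  rw [← lintegral_enorm_rpow_eq hp0 hp, ← lintegral_enorm_rpow_eq hp0 hp,
    ← lintegral_add_compl _ hA, add_comm]
  -- Off `A` only `f` contributes; on `A` both functions have norm at most `ε`, whence `2 * ε`.
  refine add_le_add ?_ ?_
  · calc ∫⁻ a in Aᶜ, ‖(f + g) a‖ₑ ^ p.toReal ∂μ = ∫⁻ a in Aᶜ, ‖f a‖ₑ ^ p.toReal ∂μ := by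
          refine lintegral_congr_ae ?_
          rw [Filter.EventuallyEq, ae_restrict_iff' hA.compl]
          filter_upwards [hgA] with a ha haA
          simp [ha haA]
      _ ≤ _ := setLIntegral_le_lintegral _ _
  · rw [lintegral_enorm_rpow_eq hp0 hp]
    gcongr
    refine (eLpNorm_add_le hf.restrict hg.restrict hp1).trans ?_
    rw [two_mul]
    exact add_le_add hfε ((eLpNorm_restrict_le _ _ _ _).trans hgε)

/-- Normalized indicators of disjoint sets are, eventually, approximately disjoint from a given
function. -/
theorem exists_separated_midpoints_Lp [Fact (1 ≤ p)] (hp : p ≠ ∞) {A : ℕ → Set α}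
    (hA : ∀ n, MeasurableSet (A n)) (hdisj : Pairwise (Function.onFun Disjoint A))
    (hA0 : ∀ n, μ (A n) ≠ 0) (hAt : ∀ n, μ (A n) ≠ ∞) (h : Lp ℝ p μ) {ε : ℝ} (hε : 0 < ε) :
    ∃ z : ℕ → Lp ℝ p μ,
      (∀ n, ‖h + z n‖ ^ p.toReal ≤ ‖h‖ ^ p.toReal + (2 * ε) ^ p.toReal ∧
        ‖h - z n‖ ^ p.toReal ≤ ‖h‖ ^ p.toReal + (2 * ε) ^ p.toReal) ∧
      ∀ m n, m ≠ n → ε ≤ ‖z m - z n‖ := by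
  have hp1 : 1 ≤ p := Fact.out
  have hp0 : p ≠ 0 := (zero_lt_one.trans_le hp1).ne'
  have hpr : 0 < p.toReal := ENNReal.toReal_pos hp0 hp
  -- The masses of `h` on the disjoint sets are summable, so they tend to zero and discarding `N`
  -- sets makes all of them small.
  have hsum : ∑' n, ∫⁻ a in A n, ‖h a‖ₑ ^ p.toReal ∂μ ≠ ∞ := by
    rw [← lintegral_iUnion hA hdisj]
    refine ((setLIntegral_le_lintegral _ _).trans_lt ?_).ne
    rw [lintegral_enorm_rpow_eq hp0 hp]
    exact ENNReal.rpow_lt_top_of_nonneg hpr.le (Lp.eLpNorm_ne_top h)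
  have hε' : 0 < ENNReal.ofReal ε := ENNReal.ofReal_pos.2 hε
  obtain ⟨N, hN⟩ := Filter.eventually_atTop.1
    ((ENNReal.tendsto_atTop_zero_of_tsum_ne_top hsum).eventually
      (ge_mem_nhds (ENNReal.rpow_pos hε' ENNReal.ofReal_ne_top : 0 < ENNReal.ofReal ε ^ p.toReal)))
  have hsmall : ∀ n, eLpNorm h p (μ.restrict (A (n + N))) ≤ ENNReal.ofReal ε := fun n => by
    rw [← ENNReal.rpow_le_rpow_iff hpr, ← lintegral_enorm_rpow_eq hp0 hp]
    exact hN _ (Nat.le_add_left N n)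
  set z : ℕ → Lp ℝ p μ := fun n => indicatorConstLp p (hA (n + N)) (hAt (n + N))
    (ε / μ.real (A (n + N)) ^ (1 / p.toReal)) with hz
  have hzn : ∀ n, ‖z n‖ = ε := fun n => by
    have : 0 < μ.real (A (n + N)) := ENNReal.toReal_pos (hA0 _) (hAt _)
    simp only [hz]
    rw [norm_indicatorConstLp hp0 hp, Real.norm_of_nonneg (by positivity)]
    field_simp
  have hzA : ∀ n, ∀ᵐ a ∂μ, a ∉ A (n + N) → z n a = 0 := fun n =>
    indicatorConstLp_coeFn_notMem
  -- Stated for a general `g` so as to cover both `z n` and `-z n`.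
  have hzsupp : ∀ n, ∀ g : Lp ℝ p μ, ‖g‖ = ε → (∀ᵐ a ∂μ, a ∉ A (n + N) → g a = 0) →
      ‖h + g‖ ^ p.toReal ≤ ‖h‖ ^ p.toReal + (2 * ε) ^ p.toReal := fun n g hg hgA => by
    have hge : eLpNorm g p μ ≤ ENNReal.ofReal ε := by
      rw [← hg, Lp.norm_def, ENNReal.ofReal_toReal (Lp.eLpNorm_ne_top g)]
    have h1 := eLpNorm_add_rpow_le hp1 hp (Lp.aestronglyMeasurable h) (Lp.aestronglyMeasurable g)
      (hA (n + N)) hgA (hsmall n) hge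
    rw [← eLpNorm_congr_ae (Lp.coeFn_add h g)] at h1
    have hfin1 : eLpNorm h p μ ^ p.toReal ≠ ∞ :=
      ENNReal.rpow_ne_top_of_nonneg hpr.le (Lp.eLpNorm_ne_top h)
    have hfin2 : (2 * ENNReal.ofReal ε) ^ p.toReal ≠ ∞ :=
      ENNReal.rpow_ne_top_of_nonneg hpr.le (ENNReal.mul_ne_top (by simp) (by simp))
    have h2 := ENNReal.toReal_mono (ENNReal.add_ne_top.2 ⟨hfin1, hfin2⟩) h1
    rw [ENNReal.toReal_add hfin1 hfin2, ← ENNReal.toReal_rpow, ← ENNReal.toReal_rpow,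
      ← ENNReal.toReal_rpow, ENNReal.toReal_mul, ENNReal.toReal_ofReal hε.le,
      ENNReal.toReal_ofNat] at h2
    exact h2
  refine ⟨z, fun n => ⟨hzsupp n _ (hzn n) (hzA n), ?_⟩, fun m n hmn => ?_⟩
  · rw [sub_eq_add_neg]
    refine hzsupp n _ ((norm_neg _).trans (hzn n)) ?_
    filter_upwards [hzA n, Lp.coeFn_neg (z n)] with a ha hna haA
    rw [hna, Pi.neg_apply, ha haA, neg_zero]
  · rw [← hzn m]
    -- By disjointness `z n` vanishes wherever `z m` may be nonzero.
    have hmem : ∀ᵐ a ∂μ, ‖z m a‖ ≤ ‖(z m - z n : Lp ℝ p μ) a‖ := by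
      filter_upwards [hzA m, hzA n, Lp.coeFn_sub (z m) (z n)] with a hma hna hs
      rw [hs, Pi.sub_apply]
      by_cases ha : a ∈ A (m + N)
      · have : a ∉ A (n + N) := fun h' =>
          Set.disjoint_left.1 (hdisj (by simpa using hmn)) ha h'
        rw [hna this, sub_zero]
      · rw [hma ha, norm_zero]
        exact norm_nonneg _
    exact Lp.norm_le_norm_of_ae_le hmem

end DisjointSupports

/-! ### Specialization to the unit interval -/

/-- The open intervals between consecutive reciprocals of positive integers. -/
def reciprocalInterval (n : ℕ) : Set ℝ := Set.Ioo (1 / ((n : ℝ) + 2)) (1 / ((n : ℝ) + 1))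

lemma measurableSet_reciprocalInterval (n : ℕ) : MeasurableSet (reciprocalInterval n) :=
  measurableSet_Ioo

lemma pairwise_disjoint_reciprocalInterval :
    Pairwise (Function.onFun Disjoint reciprocalInterval) := by
  have key : ∀ m n : ℕ, m < n → Disjoint (reciprocalInterval m) (reciprocalInterval n) := by
    intro m n hmn
    refine Set.disjoint_left.2 fun a ha hb => ?_
    have h1 := ha.1.trans hb.2
    have h2 : (m : ℝ) + 1 ≤ n := by exact_mod_cast hmn
    have h3 : 1 / ((n : ℝ) + 1) ≤ 1 / ((m : ℝ) + 2) :=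
      one_div_le_one_div_of_le (by positivity) (by linarith)
    linarith
  intro m n hmn
  rcases hmn.lt_or_gt with h | h
  · exact key m n h
  · exact (key n m h).symm

lemma restrict_Icc_reciprocalInterval (n : ℕ) :
    (volume.restrict (Set.Icc (0 : ℝ) 1)) (reciprocalInterval n)
      = ENNReal.ofReal (1 / ((n : ℝ) + 1) - 1 / ((n : ℝ) + 2)) := by
  rw [Measure.restrict_apply (measurableSet_reciprocalInterval n), Set.inter_eq_left.2, reciprocalInterval,
    Real.volume_Ioo]
  intro a ha
  have h1 : (0 : ℝ) < 1 / ((n : ℝ) + 2) := by positivity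
  have h2 : 1 / ((n : ℝ) + 1) ≤ 1 := by
    rw [div_le_one (by positivity)]
    linarith [(n.cast_nonneg : (0 : ℝ) ≤ n)]
  exact ⟨(h1.trans ha.1).le, ha.2.le.trans h2⟩

lemma exists_separated_midpoints_LqUnit {q : ℝ} (hq : 1 ≤ q) [Fact (1 ≤ ENNReal.ofReal q)]
    (h : LqUnit q) (ε : ℝ) (hε : 0 < ε) : ∃ z : ℕ → LqUnit q,
      (∀ n, ‖h + z n‖ ^ q ≤ ‖h‖ ^ q + (2 * ε) ^ q ∧ ‖h - z n‖ ^ q ≤ ‖h‖ ^ q + (2 * ε) ^ q) ∧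
      ∀ m n, m ≠ n → ε ≤ ‖z m - z n‖ := by
  have key := exists_separated_midpoints_Lp (p := ENNReal.ofReal q) ENNReal.ofReal_ne_top
    measurableSet_reciprocalInterval pairwise_disjoint_reciprocalInterval
    (fun n => by
      rw [restrict_Icc_reciprocalInterval]
      refine (ENNReal.ofReal_pos.2 (sub_pos.2 ?_)).ne'
      exact one_div_lt_one_div_of_lt (by positivity) (by linarith))
    (fun n => by
      rw [restrict_Icc_reciprocalInterval]
      exact ENNReal.ofReal_ne_top) h hε
  rwa [ENNReal.toReal_ofReal (by linarith)] at key

theorem mainTheorem8 (p q : ℝ) (hp : 1 ≤ p) (hpq : p < q)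
    [Fact (1 ≤ ENNReal.ofReal p)] [Fact (1 ≤ ENNReal.ofReal q)] :
    (∀ (Y : Type*) [NormedAddCommGroup Y] [NormedSpace ℝ Y] [CompleteSpace Y],
      IsPowerTypeAMUC p Y → ¬ BiLipschitzEmbeds (LqUnit q) Y) ∧
    ¬ BiLipschitzEmbeds (LqUnit q) (EllP p) := by
  have hq : 1 ≤ q := hp.trans hpq.le
  have : Nontrivial (LqUnit q) := by
    obtain ⟨z, -, hz⟩ := exists_separated_midpoints_LqUnit hq 0 1 one_pos
    refine ⟨z 0, z 1, fun h => ?_⟩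
    have := hz 0 1 zero_ne_one
    rw [h, sub_self, norm_zero] at this
    linarith
  have hX := exists_separated_midpoints_LqUnit hq
  exact ⟨fun Y _ _ _ hY => not_biLipschitzEmbeds_of_separated_midpoints hp hpq hY hX,
    not_biLipschitzEmbeds_of_separated_midpoints hp hpq (isPowerTypeAMUC_ellP hp) hX⟩
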